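/- For $s>0$ let $F(s)={}_2F_1(1,s;s+1;-1)$, the value at $z=-1$ of the (analytically continued) Gauss hypergeometric function; that is, by Euler's integral, $F(s)=\frac{\Gamma(s+1)}{\Gamma(s)\Gamma(1)}\int_0^1\frac{x^{s-1}}{1+x}\,dx$. Then, on $(0,\infty)$, the functions $$F(s)\quad\text{and}\quad \frac{1-F(s)}{s}$$ are strictly decreasing, while the functions $$s\left(F(s)-\tfrac12\right)\quad\text{and}\quad \frac{1-F(s)}{s\,(2F(s)-1)}$$ are strictly increasing. Moreover, for every $s>0$, $$\tfrac12<F(s)<1,\qquad 0<\frac{1-F(s)}{s}<\ln 2,\qquad 0<s\left(F(s)-\tfrac12\right)<\tfrac14,\qquad \ln 2<\frac{1-F(s)}{s\,(2F(s)-1)}<1,$$ and these estimates are sharp: in each of them the lower and upper constants are the infimum and the supremum, respectively, of the function over $s\in(0,\infty)$. -/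

import Mathlib

open Set MeasureTheory Filter Topology

/-- The Gauss hypergeometric function `₂F₁(a, b; c; z)` for real parameters `0 < b < c` and real
`z < 1`, including points `z ≤ -1` outside the open disk of convergence of the hypergeometric
series, given by Euler's integral
`Γ(c) / (Γ(b) Γ(c - b)) * ∫₀¹ x^(b-1) (1-x)^(c-b-1) / (1 - z x)^a dx`.
It agrees with the sum of the series for `|z| < 1` (`gaussHyp_eq_ordinaryHypergeometric`) and is
continuous in `z < 1` (`continuousOn_gaussHyp`). Mathlib's `ordinaryHypergeometric` is the sum of
the series only, and has a junk value at `z = -1` when convergence there is conditional. -/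
noncomputable def gaussHyp (a b c z : ℝ) : ℝ :=
  Real.Gamma c / (Real.Gamma b * Real.Gamma (c - b)) *
    ∫ x in (0 : ℝ)..1, x ^ (b - 1) * (1 - x) ^ (c - b - 1) / (1 - z * x) ^ a

theorem gaussHyp_weight_integrable {u v : ℝ} (hu : 0 < u) (hv : 0 < v) :
    IntervalIntegrable (fun x : ℝ => x ^ (u - 1) * (1 - x) ^ (v - 1)) volume 0 1 := by
  have h := Complex.betaIntegral_convergent (u := (u : ℂ)) (v := (v : ℂ)) (by simpa) (by simpa)
  rw [intervalIntegrable_iff_integrableOn_Ioc_of_le zero_le_one] at h ⊢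
  refine (IntegrableOn.congr_fun h.re (g := fun x : ℝ => x ^ (u - 1) * (1 - x) ^ (v - 1))
    ?_ measurableSet_Ioc)
  intro x hx
  have h1 : ((x : ℂ) ^ ((u : ℂ) - 1)) = ((x ^ (u - 1) : ℝ) : ℂ) := by
    rw [Complex.ofReal_cpow hx.1.le]; push_cast; rfl
  have h2 : ((1 - (x : ℂ)) ^ ((v : ℂ) - 1)) = (((1 - x) ^ (v - 1) : ℝ) : ℂ) := by
    rw [Complex.ofReal_cpow (sub_nonneg.2 hx.2)]; push_cast; rfl
  simp only [h1, h2, ← Complex.ofReal_mul]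
  simp

theorem gaussHyp_weight_integral {u v : ℝ} (hu : 0 < u) (hv : 0 < v) :
    ∫ x in (0 : ℝ)..1, x ^ (u - 1) * (1 - x) ^ (v - 1) =
      Real.Gamma u * Real.Gamma v / Real.Gamma (u + v) := by
  have h := Complex.Gamma_mul_Gamma_eq_betaIntegral (s := (u : ℂ)) (t := (v : ℂ))
    (by simpa) (by simpa)
  have h3 : Complex.betaIntegral u v =
      ((∫ x in (0 : ℝ)..1, x ^ (u - 1) * (1 - x) ^ (v - 1) : ℝ) : ℂ) := by
    rw [Complex.betaIntegral, ← intervalIntegral.integral_ofReal]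
    refine intervalIntegral.integral_congr fun x hx => ?_
    rw [uIcc_of_le zero_le_one] at hx
    have h1 : ((x : ℂ) ^ ((u : ℂ) - 1)) = ((x ^ (u - 1) : ℝ) : ℂ) := by
      rw [Complex.ofReal_cpow hx.1]; push_cast; rfl
    have h2 : ((1 - (x : ℂ)) ^ ((v : ℂ) - 1)) = (((1 - x) ^ (v - 1) : ℝ) : ℂ) := by
      rw [Complex.ofReal_cpow (sub_nonneg.2 hx.2)]; push_cast; rfl
    simp only [h1, h2, Complex.ofReal_mul]
  rw [h3, ← Complex.ofReal_add] at h
  simp only [Complex.Gamma_ofReal, ← Complex.ofReal_mul] at h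
  have h' := Complex.ofReal_injective h
  rw [eq_div_iff (Real.Gamma_pos_of_pos (by positivity)).ne', h', mul_comm]

theorem gaussHyp_Gamma_add_nat {b : ℝ} (hb : 0 < b) (n : ℕ) :
    Real.Gamma (b + n) = (ascPochhammer ℝ n).eval b * Real.Gamma b := by
  induction n with
  | zero => simp
  | succ n ih =>
    rw [Nat.cast_succ, ← add_assoc, Real.Gamma_add_one (by positivity), ih,
      ascPochhammer_succ_eval]
    ring

theorem gaussHyp_eq_ordinaryHypergeometric {a b c z : ℝ} (hb : 0 < b) (hc : b < c)
    (hz : |z| < 1) : gaussHyp a b c z = ₂F₁ a b c z := by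
  have hv : 0 < c - b := sub_pos.2 hc
  have hc0 : 0 < c := hb.trans hc
  set k : ℕ → ℝ := fun n => Ring.choose (a + n - 1) n with hk
  have hP := Real.one_div_one_sub_rpow_hasFPowerSeriesOnBall_zero a
  have hkeq : ∀ n, k n = (n.factorial : ℝ)⁻¹ * (ascPochhammer ℝ n).eval a := by
    intro n
    have h := Ring.factorial_nsmul_multichoose_eq_ascPochhammer a n
    rw [Polynomial.ascPochhammer_smeval_eq_eval, nsmul_eq_mul, Ring.multichoose_eq] at h
    rw [hk, ← h]
    field_simp
  have hsum : ∀ y : ℝ, |y| < 1 → HasSum (fun n => k n * y ^ n) (1 / (1 - y) ^ a) := by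
    intro y hy
    have h := hP.hasSum (y := y) (by simpa [enorm_eq_nnnorm] using! hy)
    simpa [FormalMultilinearSeries.ofScalars_apply_eq, hk, mul_comm] using! h
  have habs : Summable (fun n => ‖k n * z ^ n‖) := (hsum z hz).summable.norm
  set w : ℝ → ℝ := fun x => x ^ (b - 1) * (1 - x) ^ (c - b - 1) with hw
  have hwi : IntervalIntegrable w volume 0 1 := gaussHyp_weight_integrable hb hv
  have hmom : ∀ n : ℕ, ∫ x in (0 : ℝ)..1, w x * (k n * (z * x) ^ n) =
      k n * z ^ n * (Real.Gamma (b + n) * Real.Gamma (c - b) / Real.Gamma (c + n)) := by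
    intro n
    have h := gaussHyp_weight_integral (u := b + n) (v := c - b) (by positivity) hv
    rw [show b + n + (c - b) = c + n by ring] at h
    rw [← h, ← intervalIntegral.integral_const_mul]
    rw [intervalIntegral.integral_of_le zero_le_one, intervalIntegral.integral_of_le zero_le_one]
    refine setIntegral_congr_fun measurableSet_Ioc fun x hx => ?_
    simp only [hw]
    rw [show b + n - 1 = b - 1 + n by ring, Real.rpow_add hx.1, Real.rpow_natCast, mul_pow]
    ring
  have hI : HasSum (fun n : ℕ => ∫ x in (0 : ℝ)..1, w x * (k n * (z * x) ^ n))
      (∫ x in (0 : ℝ)..1, w x * (1 / (1 - z * x) ^ a)) := by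
    refine intervalIntegral.hasSum_integral_of_dominated_convergence
      (fun n x => ‖w x‖ * ‖k n * z ^ n‖) ?_ ?_ ?_ ?_ ?_
    · intro n
      refine AEStronglyMeasurable.mul ?_ (by fun_prop)
      exact (intervalIntegrable_iff.1 hwi).aestronglyMeasurable
    · intro n
      refine ae_of_all _ fun x hx => ?_
      rw [uIoc_of_le zero_le_one] at hx
      rw [norm_mul, mul_pow, ← mul_assoc, norm_mul _ (x ^ n)]
      refine mul_le_mul_of_nonneg_left ?_ (norm_nonneg _)
      refine mul_le_of_le_one_right (norm_nonneg _) ?_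
      rw [norm_pow]
      exact pow_le_one₀ (norm_nonneg _) (by rw [Real.norm_of_nonneg hx.1.le]; exact hx.2)
    · exact ae_of_all _ fun x _ => habs.mul_left _
    · simp only [tsum_mul_left]
      exact hwi.norm.mul_const _
    · refine ae_of_all _ fun x hx => ?_
      rw [uIoc_of_le zero_le_one] at hx
      refine (hsum (z * x) ?_).mul_left _
      rw [abs_mul, abs_of_pos hx.1]
      nlinarith [abs_nonneg z, hx.1, hx.2]
  simp only [hmom] at hI
  have hI' := (hI.mul_left (Real.Gamma c / (Real.Gamma b * Real.Gamma (c - b)))).tsum_eq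
  rw [ordinaryHypergeometric_eq_tsum, gaussHyp]
  simp only [mul_one_div] at hI'
  rw [← hI']
  refine tsum_congr fun n => ?_
  rw [gaussHyp_Gamma_add_nat hb, gaussHyp_Gamma_add_nat hc0, hkeq, smul_eq_mul]
  have h1 := (Real.Gamma_pos_of_pos hb).ne'
  have h2 := (Real.Gamma_pos_of_pos hv).ne'
  have h3 := (Real.Gamma_pos_of_pos hc0).ne'
  have h4 := (ascPochhammer_pos n c hc0).ne'
  field_simp

theorem continuousOn_gaussHyp (a : ℝ) {b c : ℝ} (hb : 0 < b) (hc : b < c) :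
    ContinuousOn (gaussHyp a b c) (Iio 1) := by
  intro z₀ hz₀
  have hz₀ : z₀ < 1 := hz₀
  refine ContinuousAt.continuousWithinAt ?_
  have hwi := gaussHyp_weight_integrable hb (sub_pos.2 hc)
  have hpos : ∀ z x : ℝ, z < 1 → 0 ≤ x → x ≤ 1 → 0 < 1 - z * x := by
    intro z x hz h0 h1
    nlinarith [mul_nonneg (sub_nonneg.2 hz.le) h0]
  have hcont : ContinuousOn (fun p : ℝ × ℝ => ((1 - p.1 * p.2) ^ a)⁻¹)
      (Icc (z₀ - 1) ((z₀ + 1) / 2) ×ˢ Icc 0 1) := by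
    intro p hp
    have h := hpos p.1 p.2 (by linarith [hp.1.2]) hp.2.1 hp.2.2
    refine ContinuousWithinAt.inv₀ ?_ (Real.rpow_pos_of_pos h _).ne'
    exact ContinuousWithinAt.rpow_const (by fun_prop) (Or.inl h.ne')
  obtain ⟨M, hM⟩ := (isCompact_Icc.prod isCompact_Icc).exists_bound_of_continuousOn hcont
  have hev : ∀ᶠ z in 𝓝 z₀, z ∈ Icc (z₀ - 1) ((z₀ + 1) / 2) :=
    Icc_mem_nhds (by linarith) (by linarith)
  refine ContinuousAt.mul continuousAt_const ?_
  refine intervalIntegral.continuousAt_of_dominated_interval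
    (bound := fun x => ‖x ^ (b - 1) * (1 - x) ^ (c - b - 1)‖ * M) ?_ ?_ ?_ ?_
  · refine Eventually.of_forall fun z => ?_
    simp only [div_eq_mul_inv]
    refine AEStronglyMeasurable.mul (intervalIntegrable_iff.1 hwi).aestronglyMeasurable ?_
    exact (Measurable.inv (by fun_prop)).aestronglyMeasurable
  · filter_upwards [hev] with z hz
    refine ae_of_all _ fun x hx => ?_
    rw [uIoc_of_le zero_le_one] at hx
    rw [div_eq_mul_inv, norm_mul]
    exact mul_le_mul_of_nonneg_left (hM (z, x) ⟨hz, hx.1.le, hx.2⟩) (norm_nonneg _)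
  · exact hwi.norm.mul_const _
  · refine ae_of_all _ fun x hx => ?_
    rw [uIoc_of_le zero_le_one] at hx
    have h := hpos z₀ x hz₀ hx.1.le hx.2
    refine ContinuousAt.div continuousAt_const ?_ (Real.rpow_pos_of_pos h _).ne'
    exact ContinuousAt.rpow_const (by fun_prop) (Or.inl h.ne')

/-- `F(s) = ₂F₁(1, s; s + 1; -1)`. -/
noncomputable def hypF (s : ℝ) : ℝ := gaussHyp 1 s (s + 1) (-1)

/-- The strict estimates `m < f(s) < M` for all `s > 0`, with both constants best possible. -/
def SharpBounds (f : ℝ → ℝ) (m M : ℝ) : Prop :=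
  (∀ s : ℝ, 0 < s → m < f s ∧ f s < M) ∧ IsGLB (f '' Ioi 0) m ∧ IsLUB (f '' Ioi 0) M

/-! Write `M[g](s)` for the integral of `x ^ s * g x` over `[0, 1]`. Integration by parts expresses
every function in question through moments: `F = 1/2 + M[(1+x)⁻²]`, `(1 - F)/s = M[(1+x)⁻¹]` and `s
(F - 1/2) = 1/4 - M[(1-x)/(1+x)³]`. A moment of a kernel positive on `(0, 1)` strictly decreases in
`s`, tends to the integral of the kernel as `s → 0+`, and vanishes at infinity; this settles the
first three functions, apart from the limit of the third at `0+`, which is read off its factor `s`.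

The fourth function is half the ratio `M[(1+x)⁻¹] / M[(1+x)⁻²]`, and its monotonicity is a
Chebyshev-type inequality (`rpowMoment_ratio_strictMonoOn`). At infinity the ratio is `0/0`,
resolved by multiplying both moments by `s` and integrating by parts again. -/

/-- The moment `∫₀¹ x ^ s g(x) dx`. -/
noncomputable def rpowMoment (g : ℝ → ℝ) (s : ℝ) : ℝ := ∫ x in (0 : ℝ)..1, x ^ s * g x

/-! ### Moments: positivity, monotonicity and limits -/

theorem rpowMoment_intervalIntegrable {g : ℝ → ℝ} (hg : ContinuousOn g (Icc 0 1)) {s : ℝ}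
    (hs : -1 < s) : IntervalIntegrable (fun x : ℝ => x ^ s * g x) volume 0 1 :=
  (intervalIntegral.intervalIntegrable_rpow' hs).mul_continuousOn
    (by rwa [uIcc_of_le zero_le_one])

/-- The exceptional point `a` accommodates the Chebyshev integrand, which may vanish at one interior
point; elsewhere `a = 0` makes the exception void. -/
theorem intervalIntegral_pos_of_pos_off {f : ℝ → ℝ} (hf : IntervalIntegrable f volume 0 1)
    (a : ℝ) (hpos : ∀ x ∈ Ioo (0 : ℝ) 1, x ≠ a → 0 < f x) : 0 < ∫ x in (0 : ℝ)..1, f x := by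
  have hae : ∀ᵐ x ∂(volume : Measure ℝ), x ≠ a ∧ x ≠ 1 := by
    have h1 : ∀ᵐ x ∂(volume : Measure ℝ), x ≠ a := by simp [ae_iff]
    have h2 : ∀ᵐ x ∂(volume : Measure ℝ), x ≠ 1 := by simp [ae_iff]
    exact h1.and h2
  have hpos' : ∀ᵐ x ∂(volume.restrict (Ioc (0 : ℝ) 1)), 0 < f x := by
    rw [ae_restrict_iff' measurableSet_Ioc]
    filter_upwards [hae] with x hx hx'
    exact hpos x ⟨hx'.1, lt_of_le_of_ne hx'.2 hx.2⟩ hx.1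
  rw [intervalIntegral.integral_of_le zero_le_one]
  rw [intervalIntegrable_iff_integrableOn_Ioc_of_le zero_le_one] at hf
  rw [integral_pos_iff_support_of_nonneg_ae (hpos'.mono fun x hx => hx.le) hf]
  have : Function.support f =ᵐ[volume.restrict (Ioc (0 : ℝ) 1)] (univ : Set ℝ) :=
    eventuallyEq_univ.2 (hpos'.mono fun x hx => hx.ne')
  rw [measure_congr this]
  simp

theorem rpowMoment_pos {g : ℝ → ℝ} (hg : ContinuousOn g (Icc 0 1))
    (hpos : ∀ x ∈ Ioo (0 : ℝ) 1, 0 < g x) {s : ℝ} (hs : 0 < s) : 0 < rpowMoment g s :=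
  intervalIntegral_pos_of_pos_off (rpowMoment_intervalIntegrable hg (by linarith)) 0
    fun x hx _ => mul_pos (Real.rpow_pos_of_pos hx.1 _) (hpos x hx)

theorem rpowMoment_strictAntiOn {g : ℝ → ℝ} (hg : ContinuousOn g (Icc 0 1))
    (hpos : ∀ x ∈ Ioo (0 : ℝ) 1, 0 < g x) : StrictAntiOn (rpowMoment g) (Ioi 0) := by
  intro s hs t ht hst
  have hs : 0 < s := hs
  have ht : 0 < t := ht
  have is := rpowMoment_intervalIntegrable hg (s := s) (by linarith)
  have it := rpowMoment_intervalIntegrable hg (s := t) (by linarith)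
  have h := intervalIntegral_pos_of_pos_off (is.sub it) 0 fun x hx _ => by
    have h1 := Real.rpow_lt_rpow_of_exponent_gt hx.1 hx.2 hst
    have h2 := mul_lt_mul_of_pos_right h1 (hpos x hx)
    linarith
  rw [intervalIntegral.integral_sub is it] at h
  exact sub_pos.1 h

/-- Limits of moments by dominated convergence. -/
theorem tendsto_rpowMoment {g k : ℝ → ℝ} (hg : ContinuousOn g (Icc 0 1)) {l : Filter ℝ}
    [l.IsCountablyGenerated] (hl : ∀ᶠ s in l, (0 : ℝ) < s)
    (hlim : ∀ x ∈ Ioo (0 : ℝ) 1, Tendsto (fun s : ℝ => x ^ s * g x) l (𝓝 (k x))) :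
    Tendsto (rpowMoment g) l (𝓝 (∫ x in (0 : ℝ)..1, k x)) := by
  have hgi : IntervalIntegrable g volume 0 1 :=
    ContinuousOn.intervalIntegrable (by rwa [uIcc_of_le zero_le_one])
  refine intervalIntegral.tendsto_integral_filter_of_dominated_convergence (fun x => ‖g x‖)
    ?_ ?_ hgi.norm ?_
  · filter_upwards [hl] with s hs
    exact (intervalIntegrable_iff.1
      (rpowMoment_intervalIntegrable hg (by linarith))).aestronglyMeasurable
  · filter_upwards [hl] with s hs
    refine ae_of_all _ fun x hx => ?_
    rw [uIoc_of_le zero_le_one] at hx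
    rw [norm_mul, Real.norm_of_nonneg (Real.rpow_nonneg hx.1.le _)]
    exact mul_le_of_le_one_left (norm_nonneg _) (Real.rpow_le_one hx.1.le hx.2 hs.le)
  -- The endpoint `1` is discarded, since `1 ^ s` does not tend to `0` at infinity.
  · have h2 : ∀ᵐ x ∂(volume : Measure ℝ), x ≠ 1 := by simp [ae_iff]
    filter_upwards [h2] with x hx1 hx
    rw [uIoc_of_le zero_le_one] at hx
    exact hlim x ⟨hx.1, lt_of_le_of_ne hx.2 hx1⟩

theorem tendsto_rpowMoment_zero {g : ℝ → ℝ} (hg : ContinuousOn g (Icc 0 1)) :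
    Tendsto (rpowMoment g) (𝓝[>] 0) (𝓝 (∫ x in (0 : ℝ)..1, g x)) := by
  refine tendsto_rpowMoment hg self_mem_nhdsWithin fun x hx => ?_
  have h : Tendsto (fun s : ℝ => x ^ s) (𝓝[>] 0) (𝓝 (x ^ (0 : ℝ))) :=
    ((Real.continuous_const_rpow hx.1.ne').tendsto 0).mono_left nhdsWithin_le_nhds
  simpa using h.mul_const (g x)

theorem tendsto_rpowMoment_atTop {g : ℝ → ℝ} (hg : ContinuousOn g (Icc 0 1)) :
    Tendsto (rpowMoment g) atTop (𝓝 0) := by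
  have h := tendsto_rpowMoment (k := fun _ => 0) hg (eventually_gt_atTop 0) fun x hx => by
    simpa using (tendsto_rpow_atTop_of_base_lt_one x (by linarith [hx.1]) hx.2).mul_const (g x)
  simpa using h

/-! ### Integration by parts and the moment formulas -/

theorem rpowMoment_by_parts {h h' : ℝ → ℝ} (hd : ∀ x ∈ Icc (0 : ℝ) 1, HasDerivAt h (h' x) x)
    (hc : ContinuousOn h' (Icc 0 1)) {s : ℝ} (hs : 0 < s) :
    s * rpowMoment h (s - 1) = h 1 - rpowMoment h' s := by
  have hh : ContinuousOn h (Icc 0 1) := fun x hx => (hd x hx).continuousAt.continuousWithinAt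
  have i1 := (rpowMoment_intervalIntegrable hh (s := s - 1) (by linarith)).const_mul s
  have i2 := rpowMoment_intervalIntegrable hc (s := s) (by linarith)
  have key := intervalIntegral.integral_eq_sub_of_hasDerivAt_of_le zero_le_one
    (f := fun x => x ^ s * h x) (f' := fun x => s * (x ^ (s - 1) * h x) + x ^ s * h' x)
    ((Real.continuous_rpow_const hs.le).continuousOn.mul hh)
    (fun x hx => by
      have h1 := (Real.hasDerivAt_rpow_const (p := s) (Or.inl hx.1.ne')).mul
        (hd x (Ioo_subset_Icc_self hx))
      exact h1.congr_deriv (by ring))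
    (i1.add i2)
  rw [intervalIntegral.integral_add i1 i2, intervalIntegral.integral_const_mul] at key
  simp only [Real.one_rpow, Real.zero_rpow hs.ne', one_mul, zero_mul, sub_zero] at key
  rw [rpowMoment, rpowMoment]
  linarith

/-- Shifts the exponent so that `rpowMoment_by_parts` applies to `x * g x`. -/
theorem rpowMoment_id_mul (g : ℝ → ℝ) (s : ℝ) :
    rpowMoment (fun x => x * g x) (s - 1) = rpowMoment g s := by
  rw [rpowMoment, rpowMoment, intervalIntegral.integral_of_le zero_le_one,
    intervalIntegral.integral_of_le zero_le_one]
  refine setIntegral_congr_fun measurableSet_Ioc fun x hx => ?_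
  have := Real.rpow_sub_one hx.1.ne' s
  have hx0 := hx.1.ne'
  simp only [this]
  field_simp

theorem continuousOn_inv_one_add : ContinuousOn (fun x : ℝ => (1 + x)⁻¹) (Icc 0 1) :=
  ContinuousOn.inv₀ (by fun_prop) fun x hx => by linarith [hx.1]

theorem continuousOn_inv_one_add_sq : ContinuousOn (fun x : ℝ => ((1 + x) ^ 2)⁻¹) (Icc 0 1) :=
  ContinuousOn.inv₀ (by fun_prop) fun x hx => by have := hx.1; positivity

theorem continuousOn_one_sub_div_cube :
    ContinuousOn (fun x : ℝ => (1 - x) / (1 + x) ^ 3) (Icc 0 1) :=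
  ContinuousOn.div (by fun_prop) (by fun_prop) fun x hx => by have := hx.1; positivity

theorem hasDerivAt_inv_one_add {x : ℝ} (hx : 1 + x ≠ 0) :
    HasDerivAt (fun x : ℝ => (1 + x)⁻¹) (-((1 + x) ^ 2)⁻¹) x := by
  have h := ((hasDerivAt_id x).const_add 1).fun_inv (by simpa using hx)
  exact h.congr_deriv (by simp [neg_div])

theorem hypF_eq {s : ℝ} (hs : 0 < s) : hypF s = s * rpowMoment (fun x => (1 + x)⁻¹) (s - 1) := by
  have h0 := (Real.Gamma_pos_of_pos hs).ne'
  rw [hypF, gaussHyp, Real.Gamma_add_one hs.ne', rpowMoment]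
  simp [h0, div_eq_mul_inv]

theorem hypF_eq_half_add {s : ℝ} (hs : 0 < s) :
    hypF s = 1 / 2 + rpowMoment (fun x => ((1 + x) ^ 2)⁻¹) s := by
  rw [hypF_eq hs, rpowMoment_by_parts (h' := fun x => -((1 + x) ^ 2)⁻¹)
    (fun x hx => hasDerivAt_inv_one_add (by linarith [hx.1]))
    continuousOn_inv_one_add_sq.neg hs]
  simp only [rpowMoment, mul_neg, intervalIntegral.integral_neg]
  norm_num

/-- By parts with `x/(1+x)`, whose derivative is `(1+x)⁻²` and whose value at `1` is `1/2`. -/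
theorem mul_rpowMoment_inv_one_add {s : ℝ} (hs : 0 < s) :
    s * rpowMoment (fun x => (1 + x)⁻¹) s =
      1 / 2 - rpowMoment (fun x => ((1 + x) ^ 2)⁻¹) s := by
  rw [← rpowMoment_id_mul, rpowMoment_by_parts (fun x hx => ?_) continuousOn_inv_one_add_sq hs]
  · norm_num
  · have hx : 1 + x ≠ 0 := by linarith [hx.1]
    refine ((hasDerivAt_id x).mul (hasDerivAt_inv_one_add hx)).congr_deriv ?_
    simp only [id]
    field_simp
    ring

/-- By parts with `x/(1+x)²`, whose derivative is `(1-x)/(1+x)³` and whose value at `1` is `1/4`. -/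
theorem mul_rpowMoment_inv_one_add_sq {s : ℝ} (hs : 0 < s) :
    s * rpowMoment (fun x => ((1 + x) ^ 2)⁻¹) s =
      1 / 4 - rpowMoment (fun x => (1 - x) / (1 + x) ^ 3) s := by
  rw [← rpowMoment_id_mul, rpowMoment_by_parts (fun x hx => ?_) continuousOn_one_sub_div_cube hs]
  · norm_num
  · have hx : 1 + x ≠ 0 := by linarith [hx.1]
    have h := (((hasDerivAt_id x).const_add 1).pow 2).fun_inv (by simpa using hx)
    refine ((hasDerivAt_id x).mul h).congr_deriv ?_
    simp
    field_simp
    ring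

theorem one_sub_hypF_div {s : ℝ} (hs : 0 < s) :
    (1 - hypF s) / s = rpowMoment (fun x => (1 + x)⁻¹) s := by
  rw [div_eq_iff hs.ne', hypF_eq_half_add hs]
  linarith [mul_rpowMoment_inv_one_add hs]

theorem mul_hypF_sub_half {s : ℝ} (hs : 0 < s) :
    s * (hypF s - 1 / 2) = 1 / 4 - rpowMoment (fun x => (1 - x) / (1 + x) ^ 3) s := by
  rw [← mul_rpowMoment_inv_one_add_sq hs, hypF_eq_half_add hs]
  ring

theorem one_sub_hypF_div_mul {s : ℝ} (hs : 0 < s) :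
    (1 - hypF s) / (s * (2 * hypF s - 1)) = rpowMoment (fun x => (1 + x)⁻¹) s /
      (2 * rpowMoment (fun x => ((1 + x) ^ 2)⁻¹) s) := by
  rw [← div_div, one_sub_hypF_div hs, hypF_eq_half_add hs]
  congr 1
  ring

theorem rpowMoment_inv_one_add_sq_pos {s : ℝ} (hs : 0 < s) :
    0 < rpowMoment (fun x => ((1 + x) ^ 2)⁻¹) s :=
  rpowMoment_pos continuousOn_inv_one_add_sq
    (fun x hx => by have := hx.1; positivity) hs

/-! ### Monotonicity of the ratio of moments -/

/-- A Chebyshev-type inequality: the mean of `1 + x` for the weight `x ^ s / (1 + x) ^ 2`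
increases with `s`. -/
theorem rpowMoment_ratio_strictMonoOn :
    StrictMonoOn (fun s => rpowMoment (fun x => (1 + x)⁻¹) s /
      rpowMoment (fun x => ((1 + x) ^ 2)⁻¹) s) (Ioi 0) := by
  intro s hs t ht hst
  have hs : 0 < s := hs
  have ht : 0 < t := ht
  have hA := fun {u : ℝ} (hu : 0 < u) =>
    rpowMoment_intervalIntegrable continuousOn_inv_one_add (s := u) (by linarith)
  have hB := fun {u : ℝ} (hu : 0 < u) =>
    rpowMoment_intervalIntegrable continuousOn_inv_one_add_sq (s := u) (by linarith)
  have hBs := rpowMoment_inv_one_add_sq_pos hs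
  have hBt := rpowMoment_inv_one_add_sq_pos ht
  simp only
  set a := rpowMoment (fun x => (1 + x)⁻¹) s
  set b := rpowMoment (fun x => ((1 + x) ^ 2)⁻¹) s
  set c := a / b with hc
  have hcb : a = c * b := by rw [hc]; field_simp
  -- Needed so that the base `c - 1` is nonnegative when real powers are compared below.
  have hc1 : 1 ≤ c := by
    rw [hc, one_le_div hBs]
    refine intervalIntegral.integral_mono_on zero_le_one (hB hs) (hA hs) fun x hx => ?_
    refine mul_le_mul_of_nonneg_left ?_ (Real.rpow_nonneg hx.1 _)
    refine inv_anti₀ (by linarith [hx.1]) ?_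
    nlinarith [hx.1]
  have hI := fun {u : ℝ} (hu : 0 < u) => (hA hu).sub ((hB hu).const_mul c)
  -- By the choice of `c`, the integral of `x ^ s * (x - (c - 1)) / (1 + x)²` is zero, so any
  -- multiple of it can be subtracted freely. The factor `(c - 1) ^ (t - s)` makes the new integrand
  -- change sign nowhere: it becomes a product of two factors that both switch sign at `x = c - 1`.
  have hint := (hI ht).sub ((hI hs).const_mul ((c - 1) ^ (t - s)))
  have key := intervalIntegral_pos_of_pos_off hint (c - 1) fun x hx hxc => by
    have hx0 := hx.1
    have e : x ^ t = x ^ s * x ^ (t - s) := by rw [← Real.rpow_add hx0]; ring_nf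
    have e2 : x ^ t * (1 + x)⁻¹ - c * (x ^ t * ((1 + x) ^ 2)⁻¹) -
        (c - 1) ^ (t - s) * (x ^ s * (1 + x)⁻¹ - c * (x ^ s * ((1 + x) ^ 2)⁻¹)) =
        x ^ s * ((1 + x) ^ 2)⁻¹ * ((x ^ (t - s) - (c - 1) ^ (t - s)) * (x - (c - 1))) := by
      rw [e]
      field_simp
      ring
    rw [e2]
    refine mul_pos (mul_pos (Real.rpow_pos_of_pos hx0 _) (by positivity)) ?_
    rcases lt_or_gt_of_ne hxc with h | h
    · exact mul_pos_of_neg_of_neg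
        (sub_neg.2 (Real.rpow_lt_rpow hx0.le h (sub_pos.2 hst))) (sub_neg.2 h)
    · exact mul_pos
        (sub_pos.2 (Real.rpow_lt_rpow (by linarith) h (sub_pos.2 hst))) (sub_pos.2 h)
  rw [intervalIntegral.integral_sub (hI ht) ((hI hs).const_mul _),
    intervalIntegral.integral_const_mul,
    intervalIntegral.integral_sub (hA ht) ((hB ht).const_mul c),
    intervalIntegral.integral_sub (hA hs) ((hB hs).const_mul c),
    intervalIntegral.integral_const_mul, intervalIntegral.integral_const_mul] at key
  change 0 < rpowMoment (fun x => (1 + x)⁻¹) t - c * rpowMoment (fun x => ((1 + x) ^ 2)⁻¹) t -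
    (c - 1) ^ (t - s) * (a - c * b) at key
  rw [hcb, sub_self, mul_zero, sub_zero, sub_pos] at key
  rwa [lt_div_iff₀ hBt]

/-! ### Sharp bounds from endpoint limits -/

theorem SharpBounds.of_strictMonoOn {f : ℝ → ℝ} {m M : ℝ} (hf : StrictMonoOn f (Ioi 0))
    (h0 : Tendsto f (𝓝[>] 0) (𝓝 m)) (h1 : Tendsto f atTop (𝓝 M)) : SharpBounds f m M := by
  have lower : ∀ s : ℝ, 0 < s → m ≤ f s := fun s hs => by
    refine le_of_tendsto h0 ?_
    filter_upwards [Ioo_mem_nhdsGT hs] with x hx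
    exact (hf hx.1 hs hx.2).le
  have upper : ∀ s : ℝ, 0 < s → f s ≤ M := fun s hs => by
    refine ge_of_tendsto h1 ?_
    filter_upwards [eventually_gt_atTop s] with x hx
    exact (hf hs (hs.trans hx) hx).le
  refine ⟨fun s hs => ⟨?_, ?_⟩, ⟨?_, fun y hy => ?_⟩, ⟨?_, fun y hy => ?_⟩⟩
  -- Strictness comes from comparing `s` with `s / 2`, and then with `s + 1`.
  · exact (lower _ (half_pos hs)).trans_lt (hf (half_pos hs) hs (half_lt_self hs))
  · exact (hf hs (by simp only [mem_Ioi]; linarith) (lt_add_one s)).trans_le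
      (upper (s + 1) (by linarith))
  · rintro _ ⟨s, hs, rfl⟩
    exact lower s hs
  · refine ge_of_tendsto h0 ?_
    filter_upwards [self_mem_nhdsWithin] with x hx
    exact hy (mem_image_of_mem f hx)
  · rintro _ ⟨s, hs, rfl⟩
    exact upper s hs
  · refine le_of_tendsto h1 ?_
    filter_upwards [eventually_gt_atTop 0] with x hx
    exact hy (mem_image_of_mem f hx)

theorem SharpBounds.of_strictAntiOn {f : ℝ → ℝ} {m M : ℝ} (hf : StrictAntiOn f (Ioi 0))
    (h0 : Tendsto f (𝓝[>] 0) (𝓝 M)) (h1 : Tendsto f atTop (𝓝 m)) : SharpBounds f m M := by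
  have h := SharpBounds.of_strictMonoOn (f := fun s => -f s) hf.neg h0.neg h1.neg
  have him : (fun s => -f s) '' Ioi 0 = -(f '' Ioi 0) := by
    rw [← image_neg_eq_neg, image_image]
  refine ⟨fun s hs => ⟨neg_lt_neg_iff.1 (h.1 s hs).2, neg_lt_neg_iff.1 (h.1 s hs).1⟩, ?_, ?_⟩
  · simpa [him] using h.2.2
  · simpa [him] using h.2.1

/-! ### Limit values and conclusion -/

theorem integral_inv_one_add : ∫ x in (0 : ℝ)..1, (1 + x)⁻¹ = Real.log 2 := by
  have h := intervalIntegral.integral_comp_add_left (a := 0) (b := 1) (fun x : ℝ => x⁻¹) 1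
  rw [h, integral_inv_of_pos (by norm_num) (by norm_num)]
  norm_num

theorem integral_inv_sq_one_add : ∫ x in (0 : ℝ)..1, ((1 + x) ^ 2)⁻¹ = 1 / 2 := by
  rw [intervalIntegral.integral_eq_sub_of_hasDerivAt (f := fun x => -(1 + x)⁻¹)]
  · norm_num
  · intro x hx
    rw [uIcc_of_le zero_le_one] at hx
    exact (hasDerivAt_inv_one_add (by linarith [hx.1])).neg.congr_deriv (neg_neg _)
  · refine ContinuousOn.intervalIntegrable ?_
    rw [uIcc_of_le zero_le_one]
    exact continuousOn_inv_one_add_sq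

theorem mainTheorem2 :
    StrictAntiOn hypF (Ioi 0) ∧
    StrictAntiOn (fun s : ℝ => (1 - hypF s) / s) (Ioi 0) ∧
    StrictMonoOn (fun s : ℝ => s * (hypF s - 1 / 2)) (Ioi 0) ∧
    StrictMonoOn (fun s : ℝ => (1 - hypF s) / (s * (2 * hypF s - 1))) (Ioi 0) ∧
    SharpBounds hypF (1 / 2) 1 ∧
    SharpBounds (fun s : ℝ => (1 - hypF s) / s) 0 (Real.log 2) ∧
    SharpBounds (fun s : ℝ => s * (hypF s - 1 / 2)) 0 (1 / 4) ∧
    SharpBounds (fun s : ℝ => (1 - hypF s) / (s * (2 * hypF s - 1))) (Real.log 2) 1 := by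
  have hB0 := tendsto_rpowMoment_zero continuousOn_inv_one_add_sq
  rw [integral_inv_sq_one_add] at hB0
  have hA0 := tendsto_rpowMoment_zero continuousOn_inv_one_add
  rw [integral_inv_one_add] at hA0
  have hB1 := tendsto_rpowMoment_atTop continuousOn_inv_one_add_sq
  have hA1 := tendsto_rpowMoment_atTop continuousOn_inv_one_add
  have hC1 := tendsto_rpowMoment_atTop continuousOn_one_sub_div_cube
  have ev0 : ∀ᶠ s : ℝ in 𝓝[>] 0, 0 < s := self_mem_nhdsWithin
  have ev1 : ∀ᶠ s : ℝ in atTop, 0 < s := eventually_gt_atTop 0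
  have hF : StrictAntiOn hypF (Ioi 0) :=
    StrictAntiOn.congr (f₁ := fun s => 1 / 2 + rpowMoment (fun x => ((1 + x) ^ 2)⁻¹) s)
      (fun s hs t ht hst => add_lt_add_right
        (rpowMoment_strictAntiOn continuousOn_inv_one_add_sq
          (fun x hx => by have := hx.1; positivity) hs ht hst) _)
      fun s hs => (hypF_eq_half_add hs).symm
  have hA : StrictAntiOn (fun s : ℝ => (1 - hypF s) / s) (Ioi 0) :=
    (rpowMoment_strictAntiOn continuousOn_inv_one_add
      fun x hx => by have := hx.1; positivity).congr fun s hs => (one_sub_hypF_div hs).symm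
  have hC : StrictMonoOn (fun s : ℝ => s * (hypF s - 1 / 2)) (Ioi 0) :=
    StrictMonoOn.congr (f₁ := fun s => 1 / 4 - rpowMoment (fun x => (1 - x) / (1 + x) ^ 3) s)
      (fun s hs t ht hst => sub_lt_sub_left
        (rpowMoment_strictAntiOn continuousOn_one_sub_div_cube
          (fun x hx => by
            have := hx.1
            exact div_pos (sub_pos.2 hx.2) (by positivity)) hs ht hst) _)
      fun s hs => (mul_hypF_sub_half hs).symm
  have hR : StrictMonoOn (fun s : ℝ => (1 - hypF s) / (s * (2 * hypF s - 1))) (Ioi 0) := by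
    intro s hs t ht hst
    have h := rpowMoment_ratio_strictMonoOn hs ht hst
    simp only [one_sub_hypF_div_mul hs, one_sub_hypF_div_mul ht]
    rw [mul_comm 2, ← div_div, mul_comm 2, ← div_div]
    exact div_lt_div_of_pos_right h two_pos
  refine ⟨hF, hA, hC, hR, .of_strictAntiOn hF ?_ ?_, .of_strictAntiOn hA ?_ ?_,
    .of_strictMonoOn hC ?_ ?_, .of_strictMonoOn hR ?_ ?_⟩
  · have h := hB0.const_add (1 / 2)
    norm_num at h
    refine h.congr' ?_
    filter_upwards [ev0] with s hs
    rw [hypF_eq_half_add hs]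
  · have h := hB1.const_add (1 / 2)
    rw [add_zero] at h
    refine h.congr' ?_
    filter_upwards [ev1] with s hs
    rw [hypF_eq_half_add hs]
  · refine hA0.congr' ?_
    filter_upwards [ev0] with s hs
    exact (one_sub_hypF_div hs).symm
  · refine hA1.congr' ?_
    filter_upwards [ev1] with s hs
    exact (one_sub_hypF_div hs).symm
  · have h := (tendsto_id.mono_left nhdsWithin_le_nhds).mul hB0
    rw [zero_mul] at h
    refine h.congr' ?_
    filter_upwards [ev0] with s hs
    rw [hypF_eq_half_add hs, add_sub_cancel_left]; rfl
  · have h := hC1.const_sub (1 / 4)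
    rw [sub_zero] at h
    refine h.congr' ?_
    filter_upwards [ev1] with s hs
    exact (mul_hypF_sub_half hs).symm
  · have h := hA0.div (hB0.const_mul 2) (by norm_num)
    rw [mul_one_div_cancel two_ne_zero, div_one] at h
    refine h.congr' ?_
    filter_upwards [ev0] with s hs
    exact (one_sub_hypF_div_mul hs).symm
  -- After multiplication by `s`, numerator and denominator of the `0/0` ratio tend to `1/2` and `2
  -- * (1/4)`.
  · have h := (hB1.const_sub (1 / 2)).div ((hC1.const_sub (1 / 4)).const_mul 2) (by norm_num)
    norm_num at h
    refine h.congr' ?_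
    filter_upwards [ev1] with s hs
    have h1 := mul_rpowMoment_inv_one_add hs
    have h2 := mul_rpowMoment_inv_one_add_sq hs
    rw [one_sub_hypF_div_mul hs]
    have := rpowMoment_inv_one_add_sq_pos hs
    norm_num at h1 h2 ⊢
    rw [← h1, ← h2]
    field_simp
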